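/- \textbf{Theorem (Kolmogorov zero-one law for exchangeable measures).} Let $X$ be a standard Borel space and let $p$ be an exchangeable probability measure on $X^{\mathbb N}$, i.e.\ one that is invariant under all permutations of finitely many coordinates. Let $\sigma:X^{\mathbb N}\to X^{\mathbb N}$, $(x_0,x_1,x_2,\dots)\mapsto(x_1,x_2,\dots)$ be the shift; it preserves $p$, so that its iterates form a measure-preserving dynamical system on $(X^{\mathbb N},p)$. A measurable set $A\subseteq X^{\mathbb N}$ is called a.s. shift-invariant if for every $n$ one has $1_A\circ\sigma^n=1_A$ $p$-almost surely. Write $X^{\mathbb N}_{\mathrm{tail}}$ for the set $X^{\mathbb N}$ equipped with the $\sigma$-algebra of a.s. shift-invariant sets, and $p_{\mathrm{tail}}$ for the restriction of $p$ to it. A probability measure $q$ on a measurable space $Y$ is called deterministic if its image under $y\mapsto(y,y)$ is $q\otimes q$ (equivalently, $q$ takes only the values $0$ and $1$). Two kernels $f,g$ from $X^{\mathbb N}$ to $Y$ are $p$-a.s. equal if $\int_A f(B|x)\,p(dx)=\int_A g(B|x)\,p(dx)$ for all measurable $A\subseteq X^{\mathbb N}$ and $B\subseteq Y$. Let $PX$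 be the space of probability measures on $X$. There is a unique probability measure $\mu$ on $PX$ with $$p=\int_{PX} q^{\otimes\mathbb N}\,\mu(dq),$$ and for this $\mu$ the following conditions are equivalent. \begin{enumerate} \item $p$ is ergodic under shifts: every a.s. shift-invariant measurable set has $p$-measure $0$ or $1$. \item The measure $p_{\mathrm{tail}}$ on $X^{\mathbb N}_{\mathrm{tail}}$ is deterministic. \item For every standard Borel space $Y$ and every Markov kernel $s:X^{\mathbb N}\to Y$ which is $p$-a.s. deterministic ($\mathrm{copy}_Y\circ s$ and $(s\otimes s)\circ\mathrm{copy}_{X^{\mathbb N}}$ are $p$-a.s. equal, where $\mathrm{copy}_Z:Z\to Z\times Z$ is the kernel of $z\mapsto(z,z)$) and $p$-a.s. shift-invariant ($s\circ\sigma^n$ and $s$ are $p$-a.s. equal for every $n$), the measure $s\circ p$ on $Y$ is deterministic. \item $\mu$ is a Dirac delta $\delta_q$ at some $q\in PX$. \item $p$ is an infinite product measure $\bigotimes_{n\in\mathbb N} q_n$ with $q_n\in PX$ for each $n$. \item $p$ is i.i.d.: $p=q^{\otimes\mathbb N}$ for some $q\in PX$. \end{enumerate} -/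

import Mathlib

open MeasureTheory ProbabilityTheory
open scoped ENNReal

universe u v

namespace ZeroOne

/-! ### Markov kernels up to almost sure equality -/

/-- Two kernels `f, g : X → Y` are `p`-almost surely equal if
`∫_A f(B|x) p(dx) = ∫_A g(B|x) p(dx)` for all measurable `A ⊆ X` and `B ⊆ Y`. -/
def KernelAEEq {X : Type u} {Y : Type v} [MeasurableSpace X] [MeasurableSpace Y]
    (p : Measure X) (f g : Kernel X Y) : Prop :=
  ∀ (A : Set X) (B : Set Y), MeasurableSet A → MeasurableSet B →
    ∫⁻ x in A, f x B ∂p = ∫⁻ x in A, g x B ∂p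

/-- A kernel `f : X → Y` is `p`-almost surely deterministic if `copy ∘ f` and
`(f ⊗ f) ∘ copy` are `p`-almost surely equal kernels `X → Y × Y`. -/
def KernelAEDeterministic {X : Type u} {Y : Type v} [MeasurableSpace X] [MeasurableSpace Y]
    (p : Measure X) (f : Kernel X Y) : Prop :=
  KernelAEEq p (Kernel.copy Y ∘ₖ f) ((f ∥ₖ f) ∘ₖ Kernel.copy X)

/-- A probability measure `q` on `Y` is deterministic if copying its outcome gives the same joint
law as two independent samples, `copy ∘ q = q ⊗ q`. -/
def DeterministicState {Y : Type u} [MeasurableSpace Y] (q : Measure Y) : Prop :=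
  Kernel.copy Y ∘ₘ q = q.prod q

/-! ### Measure-preserving dynamical systems and ergodicity -/

/-- A (stochastic) measure-preserving dynamical system: an action, up to almost sure equality, of
a monoid `M` on the probability space `(X, p)` by measure-preserving Markov kernels. -/
structure PSSystem (M : Type v) [Monoid M] {X : Type u} [MeasurableSpace X]
    (p : Measure X) where
  act : M → Kernel X X
  markov : ∀ m, IsMarkovKernel (act m)
  preserves : ∀ m, act m ∘ₘ p = p
  act_one : KernelAEEq p (act 1) Kernel.id
  act_mul : ∀ m n, KernelAEEq p (act (m * n)) (act m ∘ₖ act n)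

namespace PSSystem

variable {M : Type v} [Monoid M] {X : Type u} [MeasurableSpace X] {p : Measure X}

/-- A measurable set `A` is almost surely invariant if for every `m` the equation
`m(A|x) = 1_A(x)` holds `p`-almost surely. -/
def InvariantSet (D : PSSystem M p) (A : Set X) : Prop :=
  MeasurableSet A ∧ ∀ m, (fun x => D.act m x A) =ᵐ[p] A.indicator (fun _ => (1 : ℝ≥0∞))

/-- The invariant `σ`-algebra: the almost surely invariant sets. -/
abbrev invariantSigma (D : PSSystem M p) : MeasurableSpace X where
  MeasurableSet' A := D.InvariantSet A
  measurableSet_empty := ⟨MeasurableSet.empty, fun m => by simp⟩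
  measurableSet_compl A hA := by
    refine ⟨hA.1.compl, fun m => ?_⟩
    have := D.markov m
    filter_upwards [hA.2 m] with x hx
    rw [prob_compl_eq_one_sub hA.1, hx]
    by_cases h : x ∈ A <;> simp [h]
  measurableSet_iUnion A hA := by
    refine ⟨MeasurableSet.iUnion fun i => (hA i).1, fun m => ?_⟩
    have := D.markov m
    filter_upwards [ae_all_iff.2 fun i => (hA i).2 m] with x hx
    by_cases h : x ∈ ⋃ i, A i
    · obtain ⟨i, hi⟩ := Set.mem_iUnion.1 h
      rw [Set.indicator_of_mem h]
      refine le_antisymm prob_le_one ?_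
      calc (1 : ℝ≥0∞) = D.act m x (A i) := by rw [hx i, Set.indicator_of_mem hi]
        _ ≤ _ := measure_mono (Set.subset_iUnion A i)
    · rw [Set.indicator_of_notMem h]
      refine measure_iUnion_null fun i => ?_
      rw [hx i, Set.indicator_of_notMem fun hi => h (Set.mem_iUnion.2 ⟨i, hi⟩)]

theorem invariantSigma_le (D : PSSystem M p) : D.invariantSigma ≤ ‹MeasurableSpace X› :=
  fun _ hA => hA.1

/-- The measure `p_inv` induced by `p` on the space `X_inv`, which is the set `X` with the
invariant `σ`-algebra. -/
noncomputable def invariantState (D : PSSystem M p) : @Measure X D.invariantSigma :=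
  p.trim D.invariantSigma_le

/-- `p` is ergodic if every almost surely invariant set has measure `0` or `1`. -/
def IsErgodic (D : PSSystem M p) : Prop :=
  ∀ A : Set X, D.InvariantSet A → p A = 0 ∨ p A = 1

/-- A kernel `f : X → Y` is almost surely (right-)invariant if `f ∘ m` is `p`-almost surely equal
to `f` for every `m`. -/
def InvariantKernel {Y : Type*} [MeasurableSpace Y] (D : PSSystem M p) (f : Kernel X Y) : Prop :=
  ∀ m, KernelAEEq p (f ∘ₖ D.act m) f

end PSSystem

/-! ### Exchangeable measures and the shift -/

variable {X : Type u} [MeasurableSpace X]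

/-- A measure on `X^ℕ` is exchangeable if it is invariant under all finite permutations of the
coordinates. -/
def Exchangeable (p : Measure (ℕ → X)) : Prop :=
  ∀ τ : Equiv.Perm ℕ, {n | τ n ≠ n}.Finite → p.map (fun x n => x (τ n)) = p

/-- The shift `(x₀, x₁, x₂, …) ↦ (x₁, x₂, x₃, …)`. -/
def shift (x : ℕ → X) : ℕ → X := fun n => x (n + 1)

theorem measurable_shift : Measurable (shift : (ℕ → X) → ℕ → X) :=
  measurable_pi_lambda _ fun n => measurable_pi_apply (n + 1)

/-- The cyclic permutation of `{0, …, N}`, fixing everything else. -/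
def cyclePerm (N : ℕ) : Equiv.Perm ℕ where
  toFun n := if n < N then n + 1 else if n = N then 0 else n
  invFun n := if n = 0 then N else if n ≤ N then n - 1 else n
  left_inv n := by
    dsimp only
    by_cases h0 : n < N
    · rw [if_pos h0, if_neg (by omega), if_pos (by omega)]
      omega
    · by_cases h1 : n = N
      · simp [h1]
      · rw [if_neg h0, if_neg h1, if_neg (by omega), if_neg (by omega)]
  right_inv n := by
    dsimp only
    by_cases h0 : n = 0
    · simp [h0]
    · by_cases h1 : n ≤ N
      · rw [if_neg h0, if_pos h1, if_pos (by omega)]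
        omega
      · rw [if_neg h0, if_neg h1, if_neg (by omega), if_neg (by omega)]

/-- Exchangeable measures are shift-invariant. -/
theorem Exchangeable.measurePreserving_shift {p : Measure (ℕ → X)} [IsProbabilityMeasure p]
    (hp : Exchangeable p) : MeasurePreserving shift p p := by
  refine ⟨measurable_shift, ?_⟩
  have : IsProbabilityMeasure (p.map shift) :=
    Measure.isProbabilityMeasure_map measurable_shift.aemeasurable
  refine ext_of_generate_finite _ (generateFrom_measurableCylinders (α := fun _ : ℕ => X)).symm
    isPiSystem_measurableCylinders (fun B hB => ?_) (by simp)
  obtain ⟨s, S, hS, rfl⟩ := (mem_measurableCylinders _).1 hB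
  obtain ⟨N, hN⟩ : ∃ N, ∀ i ∈ s, i < N :=
    ⟨s.sup id + 1, fun i hi => Nat.lt_succ_of_le (Finset.le_sup (f := id) hi)⟩
  have hfin : {n | cyclePerm N n ≠ n}.Finite := by
    refine (Set.finite_Iic N).subset fun n hn => ?_
    by_contra h
    simp only [Set.mem_Iic, not_le] at h
    exact hn (by simp only [cyclePerm, Equiv.coe_fn_mk]; split_ifs <;> omega)
  have hm : Measurable fun (x : ℕ → X) n => x (cyclePerm N n) :=
    measurable_pi_lambda _ fun n => measurable_pi_apply _
  have hc : MeasurableSet (cylinder (α := fun _ : ℕ => X) s S) := MeasurableSet.cylinder s hS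
  conv_rhs => rw [← hp _ hfin]
  rw [Measure.map_apply measurable_shift hc, Measure.map_apply hm hc]
  congr 1
  ext x
  simp only [Set.mem_preimage, mem_cylinder]
  have : s.restrict (shift x) = s.restrict fun n => x (cyclePerm N n) := by
    ext i
    simp [shift, cyclePerm, hN i i.2]
  rw [this]

/-- The dynamical system on `(X^ℕ, p)` generated by the shift, for `p` exchangeable: the monoid
`(ℕ, +)` acts by the iterates of the shift. -/
noncomputable def shiftSystem (p : Measure (ℕ → X)) [IsProbabilityMeasure p]
    (hp : Exchangeable p) : PSSystem (Multiplicative ℕ) p where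
  act m := Kernel.deterministic (shift^[m.toAdd]) (measurable_shift.iterate _)
  markov m := inferInstance
  preserves m := by
    rw [Measure.deterministic_comp_eq_map]
    exact (hp.measurePreserving_shift.iterate _).map_eq
  act_one A B _ _ := rfl
  act_mul m n A B _ _ := by
    rw [Kernel.deterministic_comp_deterministic]
    simp only [toAdd_mul, Function.iterate_add]

/-! ### Mixtures of i.i.d. sequences -/

/-- The kernel `PX → X^ℕ` sending a probability measure `q` on `X` to the law `q ⊗ q ⊗ ⋯` of an
i.i.d. sequence with distribution `q`. -/
noncomputable def iidKernel (X : Type u) [MeasurableSpace X] :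
    Kernel (ProbabilityMeasure X) (ℕ → X) where
  toFun q := Measure.infinitePi fun _ : ℕ => (q : Measure X)
  measurable' := by
    refine Measurable.measure_of_isPiSystem_of_isProbabilityMeasure
      (generateFrom_squareCylinders (α := fun _ : ℕ => X)).symm
      (isPiSystem_squareCylinders (fun _ => MeasurableSpace.isPiSystem_measurableSet)
        fun _ => MeasurableSet.univ) ?_
    rintro _ ⟨s, t, ht, rfl⟩
    simp only [Set.mem_pi, Set.mem_univ, true_imp_iff, Set.mem_ofPred_eq] at ht
    simp_rw [Measure.infinitePi_pi _ fun i _ => ht i]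
    exact Finset.measurable_prod _ fun i _ =>
      (Measure.measurable_coe (ht i)).comp measurable_subtype_coe

/-- `μ`, a probability measure on `PX`, is a mixing measure of `p` if `p` is the `μ`-mixture of
the laws of i.i.d. sequences: `p = ∫ q ⊗ q ⊗ ⋯ μ(dq)`. -/
def IsMixingMeasure (p : Measure (ℕ → X)) (μ : Measure (ProbabilityMeasure X)) : Prop :=
  IsProbabilityMeasure μ ∧ iidKernel X ∘ₘ μ = p

end ZeroOne

/-! Existence of the mixing measure is de Finetti's theorem. Let `κ` be the conditional law of `x₀`
given the remaining coordinates, and `f x = κ x B`. By exchangeability `(x₀, σ x)` and `(x₀, σ² x)`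
have the same law, so `f` and `f ∘ σ` have inner product `∫ f²` and equal L² norms. Hence `f ∘ σ =
f` almost surely (`firstGivenRest_shift_ae_eq`). Conditioning one coordinate at a time then shows
the coordinates to be conditionally i.i.d. with law `κ`, and the law of `κ` under `p` is a mixing
measure.

The strong law of large numbers recovers `q` from a sample of `q^{⊗ℕ}`: each measurable `T ⊆ PX` has
a measurable `A ⊆ X^ℕ` that agrees almost surely with the event `q ∈ T`, for every `q`
(`exists_measurableSet_ae_iff`). So `μ T = p A` for every mixing measure, which is uniqueness. Such
an `A` is almost surely shift-invariant, so ergodicity forces `μ` to take only the values 0 and 1;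
since `PX` is countably separated, `μ` is then a Dirac mass and `p` is i.i.d.

Conversely, under a product measure an invariant set is independent of every finite block of initial
coordinates, hence of itself. Conditions 2 and 3 restate ergodicity: a deterministic state is a 0-1
measure, and a deterministic invariant kernel amounts to a family of invariant sets. -/

namespace ZeroOne

/-! ### Deterministic states and zero-one laws -/

/-- Testing on `A ×ˢ A` gives `q A = q A * q A`. Conversely, a set of measure 0 or 1 is independent
of every set, and rectangles determine the product measure. -/
theorem deterministicState_iff {Y : Type*} [MeasurableSpace Y] {q : Measure Y}
    [IsProbabilityMeasure q] :
    DeterministicState q ↔ ∀ A, MeasurableSet A → q A = 0 ∨ q A = 1 := by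
  have hcopy : Kernel.copy Y ∘ₘ q = q.map fun y => (y, y) := by
    rw [Kernel.copy, Measure.deterministic_comp_eq_map]
    rfl
  have hdiag : Measurable fun y : Y => (y, y) := measurable_id.prodMk measurable_id
  have hinter : ∀ A B : Set Y, (fun y : Y => (y, y)) ⁻¹' (A ×ˢ B) = A ∩ B := fun A B => rfl
  unfold DeterministicState
  rw [hcopy]
  constructor
  · intro h A hA
    have h1 : q A = q A * q A := by
      have := congrArg (fun ν => ν (A ×ˢ A)) h
      simpa [Measure.map_apply hdiag (hA.prod hA), hinter, Measure.prod_prod] using this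
    by_cases h0 : q A = 0
    · exact Or.inl h0
    · right
      have := (ENNReal.mul_right_inj h0 (measure_ne_top q A)).1 ((mul_one _).trans h1)
      exact this.symm
  · intro h
    refine (Measure.prod_eq fun A B hA hB => ?_).symm
    rw [Measure.map_apply hdiag (hA.prod hB), hinter]
    rcases h A hA with hA' | hA'
    · rw [hA', zero_mul]
      exact measure_mono_null Set.inter_subset_left hA'
    · rw [hA', one_mul]
      have : A =ᵐ[q] Set.univ := by
        rw [ae_eq_univ]
        exact (prob_compl_eq_zero_iff hA).2 hA'
      have h2 : (A ∩ B : Set Y) =ᵐ[q] (Set.univ ∩ B : Set Y) := this.inter (ae_eq_refl B)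
      rw [measure_congr h2, Set.univ_inter]

theorem kernelAEEq_iff {X : Type u} {Y : Type v} [MeasurableSpace X] [MeasurableSpace Y]
    {p : Measure X} [SigmaFinite p] {f g : Kernel X Y} :
    KernelAEEq p f g ↔ ∀ B, MeasurableSet B → (fun x => f x B) =ᵐ[p] fun x => g x B := by
  constructor
  · intro h B hB
    exact ae_eq_of_forall_setLIntegral_eq_of_sigmaFinite (f.measurable_coe hB)
      (g.measurable_coe hB) fun A hA _ => h A B hA hB
  · intro h A B _ hB
    exact lintegral_congr_ae (ae_restrict_of_ae (h B hB))

/-- An almost surely deterministic kernel takes, at each measurable set, only the values `0` and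
`1` almost surely. -/
theorem KernelAEDeterministic.ae_zero_or_one {X : Type u} {Y : Type v} [MeasurableSpace X]
    [MeasurableSpace Y] {p : Measure X} [SigmaFinite p] {s : Kernel X Y} [IsMarkovKernel s]
    (h : KernelAEDeterministic p s) {B : Set Y} (hB : MeasurableSet B) :
    ∀ᵐ x ∂p, s x B = 0 ∨ s x B = 1 := by
  filter_upwards [kernelAEEq_iff.1 h (B ×ˢ B) (hB.prod hB)] with x hx
  rw [Kernel.copy_comp_apply_prod _ _ hB hB, Set.inter_self, Kernel.parallelComp_comp_copy,
    Kernel.prod_apply, Measure.prod_prod] at hx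
  by_cases h0 : s x B = 0
  · exact Or.inl h0
  · exact Or.inr ((ENNReal.mul_right_inj h0 (measure_ne_top _ B)).1 ((mul_one _).trans hx)).symm

theorem kernelAEDeterministic_deterministic {X : Type u} {Y : Type v} [MeasurableSpace X]
    [MeasurableSpace Y] (p : Measure X) {f : X → Y} (hf : Measurable f) :
    KernelAEDeterministic p (Kernel.deterministic f hf) := by
  have : Kernel.copy Y ∘ₖ Kernel.deterministic f hf =
      (Kernel.deterministic f hf ∥ₖ Kernel.deterministic f hf) ∘ₖ Kernel.copy X :=
    Kernel.parallelComp_self_comp_copy.symm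
  intro A B _ _
  rw [this]

namespace PSSystem

variable {M : Type v} [Monoid M] {X : Type u} [MeasurableSpace X] {p : Measure X}

theorem isErgodic_iff_deterministicState [IsProbabilityMeasure p] (D : PSSystem M p) :
    D.IsErgodic ↔ @DeterministicState X D.invariantSigma D.invariantState := by
  have : @IsProbabilityMeasure X D.invariantSigma D.invariantState :=
    ⟨(trim_measurableSet_eq D.invariantSigma_le (@MeasurableSet.univ X D.invariantSigma)).trans
      measure_univ⟩
  rw [@deterministicState_iff X D.invariantSigma D.invariantState]
  have key : ∀ A, D.InvariantSet A → D.invariantState A = p A := fun A hA =>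
    trim_measurableSet_eq D.invariantSigma_le hA
  exact forall₂_congr fun A hA => by rw [key A hA]

end PSSystem

section Shift

variable {X : Type u} [MeasurableSpace X] {p : Measure (ℕ → X)} [IsProbabilityMeasure p]
  {hp : Exchangeable p}

theorem shiftSystem_invariantSet_iff {A : Set (ℕ → X)} :
    (shiftSystem p hp).InvariantSet A ↔
      MeasurableSet A ∧ ∀ n : ℕ, ∀ᵐ x ∂p, (shift^[n] x ∈ A ↔ x ∈ A) := by
  refine and_congr_right fun hA => ?_
  refine (Multiplicative.ofAdd.forall_congr fun n => ?_).symm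
  refine Filter.eventually_congr (Filter.Eventually.of_forall fun x => ?_)
  simp only [shiftSystem, toAdd_ofAdd, Kernel.deterministic_apply' _ _ hA]
  by_cases h1 : shift^[n] x ∈ A <;> by_cases h2 : x ∈ A <;> simp [h1, h2]

theorem shiftSystem_invariantKernel_iff {Y : Type v} [MeasurableSpace Y] {s : Kernel (ℕ → X) Y} :
    (shiftSystem p hp).InvariantKernel s ↔ ∀ n : ℕ, ∀ B, MeasurableSet B →
      ∀ᵐ x ∂p, s (shift^[n] x) B = s x B := by
  refine (Multiplicative.ofAdd.forall_congr fun n => ?_).symm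
  rw [kernelAEEq_iff]
  refine forall₂_congr fun B hB => ?_
  refine Filter.eventually_congr (Filter.Eventually.of_forall fun x => ?_)
  simp only [shiftSystem, toAdd_ofAdd, Kernel.comp_deterministic_eq_comap, Kernel.comap_apply]

/-- Since `s x B` is almost surely 0 or 1, `(s ∘ₘ p) B` is the `p`-measure of `{x | s x B = 1}`,
which inherits invariance from `s`. -/
theorem deterministicState_comp_of_isErgodic (h : (shiftSystem p hp).IsErgodic)
    {Y : Type v} [MeasurableSpace Y] {s : Kernel (ℕ → X) Y} [IsMarkovKernel s]
    (hdet : KernelAEDeterministic p s) (hinv : (shiftSystem p hp).InvariantKernel s) :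
    DeterministicState (s ∘ₘ p) := by
  rw [deterministicState_iff]
  intro B hB
  rw [shiftSystem_invariantKernel_iff] at hinv
  have hA : MeasurableSet {x | s x B = 1} := s.measurable_coe hB (measurableSet_singleton 1)
  have hsB : (s ∘ₘ p) B = p {x | s x B = 1} := by
    rw [Measure.bind_apply hB s.measurable.aemeasurable, ← lintegral_indicator_one hA]
    refine lintegral_congr_ae ?_
    filter_upwards [hdet.ae_zero_or_one hB] with x hx
    rcases hx with hx | hx <;> simp [hx, Set.indicator]
  rw [hsB]
  refine h _ (shiftSystem_invariantSet_iff.2 ⟨hA, fun n => ?_⟩)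
  filter_upwards [hinv n B hB] with x hx
  simp [hx]

/-- The indicator of an invariant set, as a map to a two-point space, is itself a deterministic
invariant kernel. -/
theorem isErgodic_of_deterministicState_comp
    (h : ∀ (Y : Type v) [MeasurableSpace Y] [StandardBorelSpace Y]
      (s : Kernel (ℕ → X) Y) [IsMarkovKernel s],
      KernelAEDeterministic p s → (shiftSystem p hp).InvariantKernel s →
        DeterministicState (s ∘ₘ p)) :
    (shiftSystem p hp).IsErgodic := by
  classical
  intro A hA
  obtain ⟨hAm, hAi⟩ := shiftSystem_invariantSet_iff.1 hA
  -- `ULift` places the two-point space in the universe over which `Y` ranges.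
  have hf : Measurable fun x : ℕ → X => (ULift.up (decide (x ∈ A)) : ULift.{v} Bool) :=
    measurable_up.comp (measurable_to_bool (by
      convert hAm using 1
      ext x
      simp))
  have hB : MeasurableSet {b : ULift.{v} Bool | b.down = true} :=
    measurable_down (measurableSet_singleton true)
  have : DiscreteMeasurableSpace (ULift.{v} Bool) :=
    ⟨fun s => (MeasurableSet.of_discrete : MeasurableSet (ULift.up ⁻¹' s : Set Bool))⟩
  have hdet := h (ULift.{v} Bool) (Kernel.deterministic _ hf)
    (kernelAEDeterministic_deterministic p hf) (shiftSystem_invariantKernel_iff.2 fun n B hB => by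
      filter_upwards [hAi n] with x hx
      simp only [Kernel.deterministic_apply, hx])
  rw [deterministicState_iff] at hdet
  have key := hdet _ hB
  rw [Measure.deterministic_comp_eq_map, Measure.map_apply hf hB] at key
  simpa using key

end Shift

/-! ### The zero-one law for i.i.d. sequences -/

theorem shift_iterate_apply {X : Type u} (n k : ℕ) (x : ℕ → X) : shift^[n] x k = x (k + n) := by
  induction n generalizing x with
  | zero => rfl
  | succ n ih =>
    rw [Function.iterate_succ_apply, ih]
    simp only [shift]
    congr 1

section Sequences

variable {X : Type u} [MeasurableSpace X]

theorem measurableSet_box {B : ℕ → Set X} (hB : ∀ i, MeasurableSet (B i)) (N : ℕ) :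
    MeasurableSet {x : ℕ → X | ∀ i < N, x i ∈ B i} := by
  have : {x : ℕ → X | ∀ i < N, x i ∈ B i} = Set.pi (Set.Iio N) B := by
    ext x
    simp
  rw [this]
  exact MeasurableSet.pi (Set.to_countable _) fun i _ => hB i

/-- Finite measures on `X^ℕ` are determined by their values on boxes in initial coordinates. -/
theorem ext_of_boxes {P Q : Measure (ℕ → X)} [IsFiniteMeasure P]
    (h : ∀ (N : ℕ) (B : ℕ → Set X), (∀ i, MeasurableSet (B i)) →
      P {x | ∀ i < N, x i ∈ B i} = Q {x | ∀ i < N, x i ∈ B i}) : P = Q := by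
  classical
  refine ext_of_generate_finite _ (generateFrom_squareCylinders (α := fun _ : ℕ => X)).symm
    (isPiSystem_squareCylinders (fun _ => MeasurableSpace.isPiSystem_measurableSet)
      fun _ => MeasurableSet.univ) ?_ ?_
  · rintro _ ⟨s, t, ht, rfl⟩
    simp only [Set.mem_pi, Set.mem_univ, true_imp_iff, Set.mem_ofPred_eq] at ht
    -- A cylinder over `s` is a box with trivial sides outside `s`; the bound `s.sup id + 1` lies
    -- strictly above every element of `s`.
    have hbox : (s : Set ℕ).pi t =
        {x | ∀ i < s.sup id + 1, x i ∈ if i ∈ s then t i else Set.univ} := by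
      ext x
      simp only [Set.mem_pi, Finset.mem_coe, Set.mem_ofPred_eq]
      refine ⟨fun hx i _ => ?_, fun hx i hi => ?_⟩
      · split_ifs with hi
        · exact hx i hi
        · trivial
      · simpa [hi] using hx i (Nat.lt_succ_of_le (Finset.le_sup (f := id) hi))
    rw [hbox]
    refine h _ _ fun i => ?_
    split_ifs
    · exact ht i
    · exact MeasurableSet.univ
  · simpa using h 0 (fun _ => Set.univ) fun _ => MeasurableSet.univ

/-- For an i.i.d. sequence, the remainder of the sequence is independent of its beginning. -/
theorem infinitePi_preimage_shift_inter_box (q : ℕ → Measure X) [∀ n, IsProbabilityMeasure (q n)]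
    {A : Set (ℕ → X)} (hA : MeasurableSet A) {B : ℕ → Set X} (hB : ∀ i, MeasurableSet (B i))
    (N : ℕ) :
    Measure.infinitePi q (shift^[N] ⁻¹' A ∩ {x | ∀ i < N, x i ∈ B i}) =
      Measure.infinitePi q (shift^[N] ⁻¹' A) *
        Measure.infinitePi q {x | ∀ i < N, x i ∈ B i} := by
  have hind : iIndepFun (fun i (x : ℕ → X) => x i) (Measure.infinitePi q) :=
    iIndepFun_infinitePi (X := fun _ x => x) fun _ => measurable_id
  have hdisj : Disjoint (Set.Ici N) (Set.Iio N) := by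
    rw [Set.disjoint_left]
    intro i hi hi'
    exact (Set.mem_Iio.1 hi').not_ge hi
  -- Disjoint blocks of independent coordinates generate independent σ-algebras.
  have hI := indep_iSup_of_disjoint (fun i => (measurable_pi_apply i).comap_le) hind.iIndep hdisj
  have hcoord : ∀ (S : Set ℕ) (i : ℕ), i ∈ S →
      Measurable[⨆ i ∈ S, MeasurableSpace.comap (fun x : ℕ → X => x i) inferInstance]
        fun x : ℕ → X => x i := by
    intro S i hi
    exact (comap_measurable _).mono
      (le_iSup₂ (f := fun i (_ : i ∈ S) =>
        MeasurableSpace.comap (fun x : ℕ → X => x i) inferInstance) i hi) le_rfl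
  refine (Indep_iff _ _ _).1 hI _ _ ?_ ?_
  · have : Measurable[⨆ i ∈ Set.Ici N,
        MeasurableSpace.comap (fun x : ℕ → X => x i) inferInstance] (shift^[N] : (ℕ → X) → _) := by
      refine @measurable_pi_lambda _ _ _ (_) _ _ fun k => ?_
      simp only [shift_iterate_apply]
      exact hcoord _ _ (Nat.le_add_left _ _)
    exact this hA
  · have : {x : ℕ → X | ∀ i < N, x i ∈ B i} = ⋂ i, ⋂ (_ : i < N), (fun x => x i) ⁻¹' B i := by
      ext x
      simp
    rw [this]
    exact MeasurableSet.iInter fun i => MeasurableSet.iInter fun hi => hcoord _ i hi (hB i)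

/-- Kolmogorov's argument: up to a null set `A` is `shift^[N] ⁻¹' A`, which does not depend on the
first `N` coordinates. -/
theorem infinitePi_zero_or_one_of_ae_invariant (q : ℕ → Measure X)
    [∀ n, IsProbabilityMeasure (q n)] {A : Set (ℕ → X)} (hA : MeasurableSet A)
    (hinv : ∀ n : ℕ, ∀ᵐ x ∂Measure.infinitePi q, (shift^[n] x ∈ A ↔ x ∈ A)) :
    Measure.infinitePi q A = 0 ∨ Measure.infinitePi q A = 1 := by
  set P := Measure.infinitePi q
  have hpre : ∀ n, (shift^[n] ⁻¹' A : Set (ℕ → X)) =ᵐ[P] A := fun n =>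
    Filter.eventuallyEq_set.2 (hinv n)
  have key : P.restrict A = P A • P := by
    refine ext_of_boxes fun N B hB => ?_
    have hbox := measurableSet_box hB N
    rw [Measure.restrict_apply hbox, Measure.smul_apply, smul_eq_mul, Set.inter_comm,
      ← measure_congr ((hpre N).inter (ae_eq_refl {x : ℕ → X | ∀ i < N, x i ∈ B i})),
      infinitePi_preimage_shift_inter_box q hA hB, measure_congr (hpre N)]
  -- Independence from all boxes extends to all measurable sets, in particular to `A` itself.
  have h1 : P A = P A * P A := by
    have := congrArg (fun ν => ν A) key
    simpa [Measure.restrict_apply hA] using this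
  by_cases h0 : P A = 0
  · exact Or.inl h0
  · exact Or.inr ((ENNReal.mul_right_inj h0 (measure_ne_top _ A)).1 ((mul_one _).trans h1)).symm

end Sequences

/-! ### De Finetti's theorem: existence of the mixing measure -/

section DeFinetti

variable {X : Type u} [MeasurableSpace X] {p : Measure (ℕ → X)} [IsProbabilityMeasure p]

/-- For an exchangeable sequence, `(x₀, x₂, x₃, …)` has the same law as `(x₀, x₁, x₂, …)`. -/
theorem Exchangeable.exists_measurePreserving_skip (hp : Exchangeable p) :
    ∃ τ : (ℕ → X) → ℕ → X, MeasurePreserving τ p p ∧ (∀ x, τ x 0 = x 0) ∧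
      ∀ x, shift (τ x) = shift (shift x) := by
  have hfin : {n | Equiv.swap 0 1 n ≠ n}.Finite := by
    refine (Set.finite_Iic 1).subset fun n hn => ?_
    by_contra h
    simp only [Set.mem_Iic, not_le] at h
    exact hn (Equiv.swap_apply_of_ne_of_ne (by omega) (by omega))
  have hswap : MeasurePreserving (fun (x : ℕ → X) n => x (Equiv.swap 0 1 n)) p p :=
    ⟨measurable_pi_lambda _ fun n => measurable_pi_apply _, hp _ hfin⟩
  -- The swap gives `(x₁, x₀, x₂, …)`, and the shift then drops `x₁`.
  refine ⟨_, hp.measurePreserving_shift.comp hswap, fun x => by simp [shift], fun x => ?_⟩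
  funext n
  simp only [shift, Function.comp_apply]
  rw [Equiv.swap_apply_of_ne_of_ne (by omega) (by omega)]

theorem iidKernel_box {B : ℕ → Set X} (hB : ∀ i, MeasurableSet (B i)) (N : ℕ)
    (q : ProbabilityMeasure X) :
    iidKernel X q {x | ∀ i < N, x i ∈ B i} = ∏ j ∈ Finset.range N, (q : Measure X) (B j) := by
  have : {x : ℕ → X | ∀ i < N, x i ∈ B i} = Set.pi (Finset.range N) B := by
    ext x
    simp
  rw [this]
  exact Measure.infinitePi_pi _ fun i _ => hB i

variable [StandardBorelSpace X] [Nonempty X]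

/-- The conditional law of the first coordinate given all the others. -/
noncomputable def firstGivenRest (p : Measure (ℕ → X)) [IsProbabilityMeasure p] :
    Kernel (ℕ → X) X :=
  condDistrib (fun x : ℕ → X => x 0) shift p

instance : IsMarkovKernel (firstGivenRest p) := by
  unfold firstGivenRest
  infer_instance

/-- Disintegration of the law of `(shift x, x 0)`. As `shift x` again has law `p`, the right-hand
side can be written at `x` instead of `shift x`. -/
theorem lintegral_indicator_mul_shift (hp : Exchangeable p) {B : Set X} (hB : MeasurableSet B)
    {g : (ℕ → X) → ℝ≥0∞} (hg : Measurable g) :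
    ∫⁻ x, B.indicator 1 (x 0) * g (shift x) ∂p = ∫⁻ x, firstGivenRest p x B * g x ∂p := by
  have hlaw : p ⊗ₘ firstGivenRest p = p.map fun x => (shift x, x 0) := by
    have : p.map shift ⊗ₘ firstGivenRest p = p.map fun x => (shift x, x 0) :=
      compProd_map_condDistrib (measurable_pi_apply 0).aemeasurable
    rwa [hp.measurePreserving_shift.map_eq] at this
  have hF : Measurable fun z : (ℕ → X) × X => B.indicator (1 : X → ℝ≥0∞) z.2 * g z.1 :=
    ((measurable_one.indicator hB).comp measurable_snd).mul (hg.comp measurable_fst)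
  have h1 := lintegral_map (μ := p) hF
    (measurable_shift.prodMk (measurable_pi_apply (X := fun _ : ℕ => X) 0))
  rw [← hlaw, Measure.lintegral_compProd hF] at h1
  rw [← h1]
  refine lintegral_congr fun x => ?_
  dsimp only
  rw [lintegral_mul_const _ (measurable_one.indicator hB), lintegral_indicator_one hB]

/-- The conditional law of the first coordinate given the others is shift-invariant. -/
theorem firstGivenRest_shift_ae_eq (hp : Exchangeable p) {B : Set X} (hB : MeasurableSet B) :
    ∀ᵐ x ∂p, firstGivenRest p (shift x) B = firstGivenRest p x B := by
  set f : (ℕ → X) → ℝ≥0∞ := fun x => firstGivenRest p x B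
  have hf : Measurable f := (firstGivenRest p).measurable_coe hB
  have hf1 : ∀ x, f x ≤ 1 := fun x => prob_le_one
  have hσ := hp.measurePreserving_shift
  obtain ⟨τ, hτ, hτ0, hτσ⟩ := hp.exists_measurePreserving_skip
  -- Both sides are integrals of `B.indicator 1 (x 0)`, against `f (shift (shift x))` and `f (shift
  -- x)` respectively; `τ` exchanges the two.
  have hprod : ∫⁻ x, f x * f (shift x) ∂p = ∫⁻ x, f x * f x ∂p := by
    have h1 := lintegral_indicator_mul_shift hp hB (hf.comp measurable_shift)
    have h2 := lintegral_indicator_mul_shift hp hB hf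
    have hm : Measurable fun x : ℕ → X => B.indicator (1 : X → ℝ≥0∞) (x 0) * f (shift x) :=
      ((measurable_one.indicator hB).comp (measurable_pi_apply 0)).mul
        (hf.comp measurable_shift)
    have h3 := hτ.lintegral_comp hm
    simp only [hτ0, hτσ] at h3
    exact h1.symm.trans (h3.trans h2)
  have hsq : ∫⁻ x, f (shift x) * f (shift x) ∂p = ∫⁻ x, f x * f x ∂p :=
    hσ.lintegral_comp (hf.mul hf)
  -- Real values are needed to expand the square `(a (shift x) - a x) ^ 2`, whose integral vanishes.
  set a : (ℕ → X) → ℝ := fun x => (f x).toReal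
  have ha : Measurable a := hf.ennreal_toReal
  have ha' : Measurable fun x => a (shift x) := ha.comp measurable_shift
  have hab : ∀ x, |a x| ≤ 1 := fun x => by
    rw [abs_of_nonneg ENNReal.toReal_nonneg]
    exact ENNReal.toReal_mono ENNReal.one_ne_top (hf1 x)
  have hint : ∀ u v : (ℕ → X) → ℝ, Measurable u → Measurable v → (∀ x, |u x| ≤ 1) →
      (∀ x, |v x| ≤ 1) → Integrable (fun x => u x * v x) p := fun u v hu hv hu1 hv1 =>
    Integrable.of_bound (hu.mul hv).aestronglyMeasurable 1 (Filter.Eventually.of_forall fun x => by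
      rw [Real.norm_eq_abs, abs_mul]
      exact mul_le_one₀ (hu1 x) (abs_nonneg _) (hv1 x))
  have hreal : ∀ u v : (ℕ → X) → ℝ≥0∞, Measurable u → Measurable v → (∀ x, u x ≤ 1) →
      (∀ x, v x ≤ 1) → ∫ x, (u x).toReal * (v x).toReal ∂p = (∫⁻ x, u x * v x ∂p).toReal := by
    intro u v hu hv hu1 hv1
    simp only [← ENNReal.toReal_mul]
    refine integral_toReal (hu.mul hv).aemeasurable (Filter.Eventually.of_forall fun x => ?_)
    exact ENNReal.mul_lt_top ((hu1 x).trans_lt ENNReal.one_lt_top)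
      ((hv1 x).trans_lt ENNReal.one_lt_top)
  have hfs : Measurable fun x => f (shift x) := hf.comp measurable_shift
  have h11 : ∫ x, a x * a (shift x) ∂p = ∫ x, a x * a x ∂p := by
    rw [hreal _ _ hf hfs hf1 fun x => hf1 _, hreal _ _ hf hf hf1 hf1, hprod]
  have h22 : ∫ x, a (shift x) * a (shift x) ∂p = ∫ x, a x * a x ∂p := by
    rw [hreal _ _ hfs hfs (fun x => hf1 _) fun x => hf1 _, hreal _ _ hf hf hf1 hf1, hsq]
  have i1 := hint a a ha ha hab hab
  have i2 := hint _ _ ha ha' hab fun x => hab (shift x)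
  have i3 := hint _ _ ha' ha' (fun x => hab (shift x)) fun x => hab (shift x)
  have hzero : ∫ x, (a (shift x) - a x) ^ 2 ∂p = 0 := by
    calc ∫ x, (a (shift x) - a x) ^ 2 ∂p
        = ∫ x, a (shift x) * a (shift x) - (a x * a (shift x) + a x * a (shift x)) + a x * a x ∂p :=
          integral_congr_ae (Filter.Eventually.of_forall fun x => by ring)
      _ = ∫ x, a (shift x) * a (shift x) - (a x * a (shift x) + a x * a (shift x)) ∂p +
            ∫ x, a x * a x ∂p := integral_add (i3.sub (i2.add i2)) i1
      _ = ∫ x, a (shift x) * a (shift x) ∂p - ∫ x, a x * a (shift x) + a x * a (shift x) ∂p +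
            ∫ x, a x * a x ∂p := by
          congr 1
          exact integral_sub i3 (i2.add i2)
      _ = 0 := by
          rw [integral_add i2 i2, h11, h22]
          ring
  have hsqint : Integrable (fun x => (a (shift x) - a x) ^ 2) p := by
    have : (fun x => (a (shift x) - a x) ^ 2) = fun x =>
        a (shift x) * a (shift x) - (a x * a (shift x) + a x * a (shift x)) + a x * a x := by
      funext x
      ring
    rw [this]
    exact (i3.sub (i2.add i2)).add i1
  rw [integral_eq_zero_iff_of_nonneg (fun x => sq_nonneg _) hsqint] at hzero
  filter_upwards [hzero] with x hx
  have hx' : a (shift x) = a x := sub_eq_zero.1 (pow_eq_zero_iff two_ne_zero |>.1 hx)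
  exact (ENNReal.toReal_eq_toReal_iff' ((hf1 _).trans_lt ENNReal.one_lt_top).ne
    ((hf1 _).trans_lt ENNReal.one_lt_top).ne).1 hx'

theorem firstGivenRest_shift_iterate_ae_eq (hp : Exchangeable p) {B : Set X}
    (hB : MeasurableSet B) (n : ℕ) :
    ∀ᵐ x ∂p, firstGivenRest p (shift^[n] x) B = firstGivenRest p x B := by
  induction n with
  | zero => exact Filter.Eventually.of_forall fun x => rfl
  | succ n ih =>
    filter_upwards [hp.measurePreserving_shift.quasiMeasurePreserving.ae ih,
      firstGivenRest_shift_ae_eq hp hB] with x h1 h2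
    rw [Function.iterate_succ_apply, h1, h2]

/-- The coordinates of an exchangeable sequence are conditionally i.i.d. given its remainder. -/
theorem lintegral_prod_indicator_mul_shift_iterate (hp : Exchangeable p) (k : ℕ)
    {B : ℕ → Set X} (hB : ∀ i, MeasurableSet (B i)) {g : (ℕ → X) → ℝ≥0∞} (hg : Measurable g) :
    ∫⁻ x, (∏ j ∈ Finset.range k, (B j).indicator 1 (x j)) * g (shift^[k] x) ∂p =
      ∫⁻ x, (∏ j ∈ Finset.range k, firstGivenRest p x (B j)) * g x ∂p := by
  -- Both `B` and `g` vary: removing coordinate 0 reindexes the sets, and its conditional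
  -- probability is absorbed into `g`.
  induction k generalizing B g with
  | zero => simp
  | succ k ih =>
    have hκ : ∀ i, Measurable fun x => firstGivenRest p x (B i) :=
      fun i => (firstGivenRest p).measurable_coe (hB i)
    have hG : Measurable fun y : ℕ → X =>
        (∏ j ∈ Finset.range k, (B (j + 1)).indicator (1 : X → ℝ≥0∞) (y j)) * g (shift^[k] y) :=
      (Finset.measurable_prod _ fun j _ =>
        (measurable_one.indicator (hB (j + 1))).comp (measurable_pi_apply j)).mul
        (hg.comp (measurable_shift.iterate k))
    calc ∫⁻ x, (∏ j ∈ Finset.range (k + 1), (B j).indicator 1 (x j)) * g (shift^[k + 1] x) ∂p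
        = ∫⁻ x, (B 0).indicator 1 (x 0) *
            ((∏ j ∈ Finset.range k, (B (j + 1)).indicator (1 : X → ℝ≥0∞) (shift x j)) *
              g (shift^[k] (shift x))) ∂p := by
          refine lintegral_congr fun x => ?_
          rw [Finset.prod_range_succ', Function.iterate_succ_apply, mul_comm (∏ j ∈ _, _),
            mul_assoc]
          rfl
      _ = ∫⁻ x, firstGivenRest p x (B 0) *
            ((∏ j ∈ Finset.range k, (B (j + 1)).indicator (1 : X → ℝ≥0∞) (x j)) *
              g (shift^[k] x)) ∂p := lintegral_indicator_mul_shift hp (hB 0) hG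
      -- Shift-invariance makes the factor for `B 0` a function of `shift^[k] x`, as the induction
      -- hypothesis requires.
      _ = ∫⁻ x, (∏ j ∈ Finset.range k, (B (j + 1)).indicator (1 : X → ℝ≥0∞) (x j)) *
            (firstGivenRest p (shift^[k] x) (B 0) * g (shift^[k] x)) ∂p := by
          refine lintegral_congr_ae ?_
          filter_upwards [firstGivenRest_shift_iterate_ae_eq hp (hB 0) k] with x hx
          rw [hx]
          ring
      _ = ∫⁻ x, (∏ j ∈ Finset.range k, firstGivenRest p x (B (j + 1))) *
            (firstGivenRest p x (B 0) * g x) ∂p :=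
          ih (fun i => hB (i + 1)) ((hκ 0).mul hg)
      _ = _ := by
          refine lintegral_congr fun x => ?_
          rw [Finset.prod_range_succ', mul_assoc]

/-- The mixing measure is the law under `p` of the random measure `firstGivenRest p x`; on boxes the
claim is the product formula with `g = 1`. -/
theorem Exchangeable.exists_isMixingMeasure (hp : Exchangeable p) :
    ∃ μ : Measure (ProbabilityMeasure X), IsMixingMeasure p μ := by
  set K : (ℕ → X) → ProbabilityMeasure X := fun x => ⟨firstGivenRest p x, inferInstance⟩
  have hK : Measurable K := (firstGivenRest p).measurable.subtype_mk
  refine ⟨p.map K, Measure.isProbabilityMeasure_map hK.aemeasurable, ?_⟩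
  symm
  refine ext_of_boxes fun N B hB => ?_
  have hbox := measurableSet_box hB N
  rw [Measure.bind_apply hbox (iidKernel X).measurable.aemeasurable,
    lintegral_map ((iidKernel X).measurable_coe hbox) hK]
  simp only [iidKernel_box hB]
  have h := lintegral_prod_indicator_mul_shift_iterate hp N hB (g := 1) measurable_one
  simp only [Pi.one_apply, mul_one] at h
  refine Eq.trans ?_ h
  rw [← lintegral_indicator_one hbox]
  refine lintegral_congr fun x => ?_
  by_cases hx : ∀ i < N, x i ∈ B i
  · rw [Set.indicator_of_mem (by exact hx), Finset.prod_eq_one]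
    · rfl
    · intro j hj
      rw [Set.indicator_of_mem (hx j (Finset.mem_range.1 hj))]
      rfl
  · rw [Set.indicator_of_notMem (by exact hx)]
    push Not at hx
    obtain ⟨i, hi, hxi⟩ := hx
    rw [Finset.prod_eq_zero (Finset.mem_range.2 hi) (Set.indicator_of_notMem hxi _)]

end DeFinetti

/-! ### Recovering the mixing measure from the sequence -/

section Mixing

variable {X : Type u} [MeasurableSpace X]

instance (q : ProbabilityMeasure X) : IsProbabilityMeasure (iidKernel X q) :=
  inferInstanceAs (IsProbabilityMeasure (Measure.infinitePi fun _ : ℕ => (q : Measure X)))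

/-- The limiting empirical frequency of `B` along a sequence. -/
noncomputable def limitFrequency (B : Set X) (x : ℕ → X) : ℝ :=
  Filter.limsup (fun n : ℕ => (∑ i ∈ Finset.range n, B.indicator (1 : X → ℝ) (x i)) / n)
    Filter.atTop

theorem measurable_limitFrequency {B : Set X} (hB : MeasurableSet B) :
    Measurable (limitFrequency B) := by
  refine Measurable.limsup fun n => Measurable.div_const ?_ _
  exact Finset.measurable_sum _ fun i _ =>
    (measurable_one.indicator hB).comp (measurable_pi_apply i)

/-- This is the strong law of large numbers. Using `limsup` makes the frequency defined and
measurable on all sequences. -/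
theorem limitFrequency_ae_eq (q : ProbabilityMeasure X) {B : Set X} (hB : MeasurableSet B) :
    ∀ᵐ x ∂iidKernel X q, limitFrequency B x = (q : Measure X).real B := by
  have hind : Measurable (B.indicator (1 : X → ℝ)) := measurable_one.indicator hB
  have heval : ∀ i : ℕ, Measurable fun x : ℕ → X => x i := fun i => measurable_pi_apply i
  have hmap : ∀ i, (iidKernel X q).map (fun x : ℕ → X => x i) = q := fun i =>
    Measure.infinitePi_map_eval (fun _ : ℕ => (q : Measure X)) i
  have hint : Integrable (B.indicator (1 : X → ℝ)) (q : Measure X) :=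
    (integrable_const (1 : ℝ)).indicator hB
  have hindep : iIndepFun (fun i (x : ℕ → X) => B.indicator (1 : X → ℝ) (x i)) (iidKernel X q) :=
    iIndepFun_infinitePi (P := fun _ : ℕ => (q : Measure X)) fun _ => hind
  have hmean : ∫ x, B.indicator (1 : X → ℝ) (x 0) ∂iidKernel X q = (q : Measure X).real B := by
    rw [← integral_indicator_one hB, ← hmap 0,
      integral_map (heval 0).aemeasurable hind.aestronglyMeasurable]
  have h := strong_law_ae_real (μ := iidKernel X q)
    (fun i (x : ℕ → X) => B.indicator (1 : X → ℝ) (x i))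
    (Integrable.comp_measurable (g := B.indicator (1 : X → ℝ)) (f := fun x : ℕ → X => x 0)
      (by rwa [hmap 0]) (heval 0))
    (fun i j hij => hindep.indepFun hij)
    (fun i => (IdentDistrib.mk (heval i).aemeasurable (heval 0).aemeasurable
      ((hmap i).trans (hmap 0).symm)).comp hind)
  rw [hmean] at h
  filter_upwards [h] with x hx
  exact hx.limsup_eq

/-- Every measurable property of a distribution can be read off, almost surely, from an i.i.d.
sample of it. -/
theorem exists_measurableSet_ae_iff {T : Set (ProbabilityMeasure X)} (hT : MeasurableSet T) :
    ∃ A : Set (ℕ → X), MeasurableSet A ∧ ∀ q, ∀ᵐ x ∂iidKernel X q, (x ∈ A ↔ q ∈ T) := by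
  -- The sets `T` with the desired property form a σ-algebra. The exceptional null set may depend on
  -- `q`, so only countable unions of null sets occur.
  let m : MeasurableSpace (ProbabilityMeasure X) :=
    { MeasurableSet' := fun T =>
        ∃ A : Set (ℕ → X), MeasurableSet A ∧ ∀ q, ∀ᵐ x ∂iidKernel X q, (x ∈ A ↔ q ∈ T)
      measurableSet_empty :=
        ⟨∅, MeasurableSet.empty, fun q => Filter.Eventually.of_forall fun x => by simp⟩
      measurableSet_compl := by
        rintro T ⟨A, hA, h⟩
        refine ⟨Aᶜ, hA.compl, fun q => ?_⟩
        filter_upwards [h q] with x hx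
        exact not_congr hx
      measurableSet_iUnion := by
        intro T hT
        choose A hA h using hT
        refine ⟨⋃ i, A i, MeasurableSet.iUnion hA, fun q => ?_⟩
        filter_upwards [ae_all_iff.2 fun i => h i q] with x hx
        simp only [Set.mem_iUnion, hx] }
  -- The evaluations `q ↦ q B` are `m`-measurable, by limiting frequencies; they generate the
  -- σ-algebra of `PX`, which is therefore contained in `m`.
  have hval : @Measurable _ _ m _ (Subtype.val : ProbabilityMeasure X → Measure X) := by
    refine @Measure.measurable_of_measurable_coe _ _ _ m _ fun B hB S hS => ?_
    refine ⟨(fun x => ENNReal.ofReal (limitFrequency B x)) ⁻¹' S,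
      (measurable_limitFrequency hB).ennreal_ofReal hS, fun q => ?_⟩
    filter_upwards [limitFrequency_ae_eq q hB] with x hx
    simp only [Set.mem_preimage, hx, measureReal_def, ENNReal.ofReal_toReal (measure_ne_top _ B)]
    rfl
  exact measurable_iff_comap_le.1 hval T hT

theorem iidKernel_apply_of_ae_iff {A : Set (ℕ → X)} {T : Set (ProbabilityMeasure X)}
    (h : ∀ q, ∀ᵐ x ∂iidKernel X q, (x ∈ A ↔ q ∈ T)) (q : ProbabilityMeasure X) :
    iidKernel X q A = T.indicator 1 q := by
  by_cases hq : q ∈ T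
  · rw [Set.indicator_of_mem hq, Pi.one_apply]
    refine (measure_congr (Filter.eventuallyEq_set.2 ?_)).trans measure_univ
    filter_upwards [h q] with x hx
    simp [hx, hq]
  · rw [Set.indicator_of_notMem hq]
    refine (measure_congr (Filter.eventuallyEq_set.2 ?_)).trans measure_empty
    filter_upwards [h q] with x hx
    simp [hx, hq]

variable {p : Measure (ℕ → X)} {μ ν : Measure (ProbabilityMeasure X)}

theorem IsMixingMeasure.apply_of_ae_iff (hμ : IsMixingMeasure p μ) {A : Set (ℕ → X)}
    {T : Set (ProbabilityMeasure X)} (hA : MeasurableSet A) (hT : MeasurableSet T)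
    (h : ∀ q, ∀ᵐ x ∂iidKernel X q, (x ∈ A ↔ q ∈ T)) : μ T = p A := by
  rw [← hμ.2, Measure.bind_apply hA (iidKernel X).measurable.aemeasurable,
    ← lintegral_indicator_one hT]
  exact lintegral_congr fun q => (iidKernel_apply_of_ae_iff h q).symm

theorem IsMixingMeasure.unique (hμ : IsMixingMeasure p μ) (hν : IsMixingMeasure p ν) : μ = ν := by
  ext T hT
  obtain ⟨A, hA, h⟩ := exists_measurableSet_ae_iff hT
  rw [hμ.apply_of_ae_iff hA hT h, hν.apply_of_ae_iff hA hT h]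

theorem measurePreserving_shift_iidKernel (q : ProbabilityMeasure X) :
    MeasurePreserving shift (iidKernel X q) (iidKernel X q) :=
  ⟨measurable_shift, Measure.map_infinitePi_infinitePi_of_inj
    (P := fun _ : ℕ => (q : Measure X)) (add_left_injective 1)⟩

/-- Under each `iidKernel X q`, which the shift preserves, both memberships almost surely amount to
`q ∈ T`; this passes to the mixture. -/
theorem IsMixingMeasure.ae_shift_mem_iff (hμ : IsMixingMeasure p μ) {A : Set (ℕ → X)}
    {T : Set (ProbabilityMeasure X)} (hA : MeasurableSet A)
    (h : ∀ q, ∀ᵐ x ∂iidKernel X q, (x ∈ A ↔ q ∈ T)) (n : ℕ) :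
    ∀ᵐ x ∂p, (shift^[n] x ∈ A ↔ x ∈ A) := by
  have hm : MeasurableSet {x | shift^[n] x ∈ A ↔ x ∈ A} :=
    MeasurableSet.iff (measurable_shift.iterate n hA) hA
  rw [← hμ.2, Measure.ae_comp_iff hm]
  refine Filter.Eventually.of_forall fun q => ?_
  filter_upwards [h q, ((measurePreserving_shift_iidKernel q).iterate
    n).quasiMeasurePreserving.ae (h q)] with x h1 h2
  rw [h1, h2]

/-- A probability measure is determined by its values on a countable generating algebra, and these
values by comparison with rationals. -/
instance [MeasurableSpace.CountablyGenerated X] :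
    MeasurableSpace.CountablySeparated (ProbabilityMeasure X) := by
  let C : Set (Set X) := generateSetAlgebra (MeasurableSpace.countableGeneratingSet X)
  have hCc : C.Countable :=
    countable_generateSetAlgebra MeasurableSpace.countable_countableGeneratingSet
  have hCgen : MeasurableSpace.generateFrom C = ‹MeasurableSpace X› := by
    rw [generateFrom_generateSetAlgebra_eq, MeasurableSpace.generateFrom_countableGeneratingSet]
  have hCm : ∀ B ∈ C, MeasurableSet B := fun B hB => by
    rw [← hCgen]
    exact MeasurableSpace.measurableSet_generateFrom hB
  have hCpi : IsPiSystem C := fun s hs t ht _ => isSetAlgebra_generateSetAlgebra.inter_mem hs ht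
  refine ⟨⟨⋃ B ∈ C, Set.range fun r : ℚ =>
    {q : ProbabilityMeasure X | (q : Measure X).real B < r}, hCc.biUnion fun B _ =>
      Set.countable_range _, ?_, ?_⟩⟩
  · intro s hs
    simp only [Set.mem_iUnion, Set.mem_range] at hs
    obtain ⟨B, hB, r, rfl⟩ := hs
    exact measurableSet_lt ((Measure.measurable_coe (hCm B hB)).comp
      measurable_subtype_coe).ennreal_toReal measurable_const
  · intro q _ q' _ h
    have hreal : ∀ B ∈ C, (q : Measure X).real B = (q' : Measure X).real B := by
      intro B hB
      have hlt : ∀ r : ℚ, (q : Measure X).real B < r ↔ (q' : Measure X).real B < r := fun r =>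
        h {q : ProbabilityMeasure X | (q : Measure X).real B < r}
          (Set.mem_biUnion hB (Set.mem_range_self r))
      refine le_antisymm (le_of_not_gt fun hgt => ?_) (le_of_not_gt fun hgt => ?_)
      · obtain ⟨r, hr1, hr2⟩ := exists_rat_btwn hgt
        exact ((hlt r).2 hr1).not_gt hr2
      · obtain ⟨r, hr1, hr2⟩ := exists_rat_btwn hgt
        exact ((hlt r).1 hr1).not_gt hr2
    have hq : IsProbabilityMeasure (q : Measure X) := q.2
    refine Subtype.ext (@ext_of_generate_finite _ _ (q : Measure X) q' C hCgen.symm hCpi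
      inferInstance (fun B hB => ?_) (by simp))
    exact (measureReal_eq_measureReal_iff (measure_ne_top _ _) (measure_ne_top _ _)).1 (hreal B hB)

/-- For each set of a countable separating family, it or its complement has full measure.
Intersecting these choices leaves a set of full measure with at most one point. -/
theorem exists_eq_dirac_of_zero_or_one {Z : Type*} [MeasurableSpace Z]
    [MeasurableSpace.CountablySeparated Z] (μ : Measure Z) [IsProbabilityMeasure μ]
    (h : ∀ T, MeasurableSet T → μ T = 0 ∨ μ T = 1) : ∃ z, μ = Measure.dirac z := by
  have : Nonempty Z := nonempty_of_isProbabilityMeasure μ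
  obtain ⟨z, hz⟩ := Filter.exists_singleton_mem_of_forall_separating (l := ae μ) MeasurableSet
    fun T hT => by
      rw [compl_mem_ae_iff, mem_ae_iff, prob_compl_eq_zero_iff hT]
      exact (h T hT).symm
  refine ⟨z, ?_⟩
  ext T hT
  rw [Measure.dirac_apply' z hT]
  by_cases hzT : z ∈ T
  · rw [Set.indicator_of_mem hzT, Pi.one_apply, ← prob_compl_eq_zero_iff hT]
    exact measure_mono_null (Set.compl_subset_compl.2 (Set.singleton_subset_iff.2 hzT))
      (mem_ae_iff.1 hz)
  · rw [Set.indicator_of_notMem hzT]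
    refine measure_mono_null (t := {z}ᶜ) ?_ (mem_ae_iff.1 hz)
    rintro y hy rfl
    exact hzT hy

/-! ### Ergodicity, Dirac mixing measures and product measures -/

theorem isMixingMeasure_dirac_iff {q : ProbabilityMeasure X} :
    IsMixingMeasure p (Measure.dirac q) ↔ p = Measure.infinitePi fun _ : ℕ => (q : Measure X) := by
  have : iidKernel X ∘ₘ Measure.dirac q = Measure.infinitePi fun _ : ℕ => (q : Measure X) :=
    Measure.dirac_bind (iidKernel X).measurable q
  unfold IsMixingMeasure
  rw [this]
  exact ⟨fun h => h.2.symm, fun h => ⟨inferInstance, h.symm⟩⟩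

theorem IsMixingMeasure.exists_eq_dirac_of_isErgodic [MeasurableSpace.CountablyGenerated X]
    [IsProbabilityMeasure p] {hp : Exchangeable p} (hμ : IsMixingMeasure p μ)
    (herg : (shiftSystem p hp).IsErgodic) : ∃ q, μ = Measure.dirac q := by
  have := hμ.1
  refine exists_eq_dirac_of_zero_or_one μ fun T hT => ?_
  obtain ⟨A, hA, h⟩ := exists_measurableSet_ae_iff hT
  rw [hμ.apply_of_ae_iff hA hT h]
  exact herg A (shiftSystem_invariantSet_iff.2 ⟨hA, hμ.ae_shift_mem_iff hA h⟩)

theorem isErgodic_of_eq_infinitePi [IsProbabilityMeasure p] {hp : Exchangeable p}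
    {q : ℕ → ProbabilityMeasure X} (h : p = Measure.infinitePi fun n => (q n : Measure X)) :
    (shiftSystem p hp).IsErgodic := by
  intro A hA
  obtain ⟨hAm, hAi⟩ := shiftSystem_invariantSet_iff.1 hA
  rw [h] at hAi ⊢
  exact infinitePi_zero_or_one_of_ae_invariant _ hAm hAi

/-- The factors of an exchangeable product measure are all equal. -/
theorem Exchangeable.eq_of_eq_infinitePi [IsProbabilityMeasure p] (hp : Exchangeable p)
    {q : ℕ → ProbabilityMeasure X} (h : p = Measure.infinitePi fun n => (q n : Measure X)) (n : ℕ) :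
    q n = q 0 := by
  have hmarg : ∀ n, p.map (fun x => x n) = q n := fun n => by
    rw [h]
    exact Measure.infinitePi_map_eval (fun n => (q n : Measure X)) n
  induction n with
  | zero => rfl
  | succ n ih =>
    rw [← ih]
    refine Subtype.ext ?_
    change (q (n + 1) : Measure X) = q n
    rw [← hmarg, ← hmarg n]
    -- Replacing `p` by its image under the shift turns coordinate `n` into coordinate `n + 1`.
    conv_rhs => rw [← hp.measurePreserving_shift.map_eq]
    rw [Measure.map_map (measurable_pi_apply n) measurable_shift]
    rfl

end Mixing

end ZeroOne

theorem mainTheorem10 {X : Type u} [MeasurableSpace X] [StandardBorelSpace X]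
    (p : Measure (ℕ → X)) [IsProbabilityMeasure p] (hp : ZeroOne.Exchangeable p) :
    (∃! μ : Measure (ProbabilityMeasure X), ZeroOne.IsMixingMeasure p μ) ∧
    ∀ μ : Measure (ProbabilityMeasure X), ZeroOne.IsMixingMeasure p μ →
      List.TFAE [
        (ZeroOne.shiftSystem p hp).IsErgodic,
        @ZeroOne.DeterministicState (ℕ → X) (ZeroOne.shiftSystem p hp).invariantSigma
          (ZeroOne.shiftSystem p hp).invariantState,
        ∀ (Y : Type v) [MeasurableSpace Y] [StandardBorelSpace Y]
          (s : Kernel (ℕ → X) Y) [IsMarkovKernel s],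
          ZeroOne.KernelAEDeterministic p s → (ZeroOne.shiftSystem p hp).InvariantKernel s →
            ZeroOne.DeterministicState (s ∘ₘ p),
        ∃ q : ProbabilityMeasure X, μ = Measure.dirac q,
        ∃ q : ℕ → ProbabilityMeasure X, p = Measure.infinitePi fun n => (q n : Measure X),
        ∃ q : ProbabilityMeasure X, p = Measure.infinitePi fun _ : ℕ => (q : Measure X)] := by
  -- The conditional distribution behind `firstGivenRest` requires a nonempty target.
  have : Nonempty X := (nonempty_of_isProbabilityMeasure p).map fun x => x 0
  constructor
  · obtain ⟨μ, hμ⟩ := hp.exists_isMixingMeasure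
    exact ⟨μ, hμ, fun ν hν => hν.unique hμ⟩
  intro μ hμ
  tfae_have 1 ↔ 2 := ZeroOne.PSSystem.isErgodic_iff_deterministicState _
  tfae_have 1 → 3 := fun h Y _ _ s _ hdet hinv =>
    ZeroOne.deterministicState_comp_of_isErgodic h hdet hinv
  tfae_have 3 → 1 := ZeroOne.isErgodic_of_deterministicState_comp
  tfae_have 1 → 4 := hμ.exists_eq_dirac_of_isErgodic
  tfae_have 4 → 6 := by
    rintro ⟨q, rfl⟩
    exact ⟨q, ZeroOne.isMixingMeasure_dirac_iff.1 hμ⟩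
  tfae_have 6 → 5 := fun ⟨q, hq⟩ => ⟨fun _ => q, hq⟩
  tfae_have 5 → 6 := fun ⟨q, hq⟩ => ⟨q 0, by simpa only [hp.eq_of_eq_infinitePi hq] using hq⟩
  tfae_have 5 → 1 := fun ⟨q, hq⟩ => ZeroOne.isErgodic_of_eq_infinitePi hq
  tfae_finish
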